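/- **Conventions.** For a ring $\Lambda$, $\Lambda\text{-mod}$ is the category of finitely generated left $\Lambda$-modules. An Artin algebra is a ring that is a finitely generated module over a commutative artinian ring $R$ over which it is an algebra. Let $\Lambda$ be an Artin algebra and let $F$ be an additive subbifunctor of $\mathrm{Ext}^1_\Lambda(-,-)$ on $\Lambda\text{-mod}$. A short exact sequence $0\to X\to Y\to Z\to 0$ in $\Lambda\text{-mod}$ is called *$F$-exact* if its class lies in $F(Z,X)$. A module $P$ is *$F$-projective* (resp. $I$ is *$F$-injective*) if $\mathrm{Hom}(P,-)$ (resp. $\mathrm{Hom}(-,I)$) sends $F$-exact sequences to exact sequences; $\mathcal P(F)$ is the class of $F$-projective modules. $F$ has *enough projectives* if every $Z$ is the right end of an $F$-exact sequence $0\to X\to P\to Z\to 0$ with $P$ $F$-projective, and *enough injectives* if every $X$ is the left end of an $F$-exact sequence $0\to X\to I\to Z\to 0$ with $I$ $F$-injective. A complex $X^\bullet$ is *$F$-acyclic* if $0\to\operatorname{Im}d^{i-1}\to X^i\to\operatorname{Im}d^i\to 0$ is $F$-exact for every $i$. The bounded relative derived category $D^b_F(\Lambda)$ is the Verdier quotient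 of the bounded homotopy category $K^b(\Lambda\text{-mod})$ by the $F$-acyclic complexes, and $D^b(\Gamma)$ is the usual bounded derived category of $\Gamma\text{-mod}$. The *$F$-stable Grothendieck group* $F\text{-}K_0(\Lambda\text{-mod})$ is the free abelian group on the isomorphism classes $[X]$ of modules in $\Lambda\text{-mod}$, modulo the subgroup generated by the elements $[X]+[Z]-[Y]$ for all $F$-exact sequences $0\to X\to Y\to Z\to 0$; $K_0(\Gamma\text{-mod})$ is defined in the same way from all short exact sequences in $\Gamma\text{-mod}$. **Proposition 6.3.** Let $\Lambda$ and $\Gamma$ be Artin algebras, and let $F$ be an additive subbifunctor of $\mathrm{Ext}^1_\Lambda(-,-)$ that has enough projectives and enough injectives and for which there is $G\in\Lambda\text{-mod}$ with $\mathcal P(F)=\operatorname{add}G$, the class of direct summands of finite direct sums of copies of $G$. Suppose that $\Lambda$ and $\Gamma$ are relatively derived equivalent, that is, $D^b_F(\Lambda)$ and $D^b(\Gamma)$ are equivalent as triangulated categories. Then there is an isomorphism of abelian groups $$F\text{-}K_0(\Lambda\text{-mod})\;\cong\;K_0(\Gamma\text{-mod}).$$ -/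

import Mathlib

universe w v v₁ v₂ u u₁ u₂

noncomputable section

open CategoryTheory Limits Pretriangulated ZeroObject
open CategoryTheory.Abelian (Ext)

namespace RelHom

/-! ### Bounded homotopy categories and bounded derived categories -/

section Bounded

variable (A : Type u) [Category.{v} A] [Abelian A]

/-- The objects of the homotopy category of cochain complexes whose underlying complex is bounded
(on both sides). As for Mathlib's `HomotopyCategory.plus`, this is not closed under isomorphisms. -/
def bounded : ObjectProperty (HomotopyCategory A (.up ℤ)) :=
  fun X ↦ ∃ a b : ℤ, CochainComplex.IsStrictlyGE X.as a ∧ CochainComplex.IsStrictlyLE X.as b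

instance : (bounded A).ContainsZero where
  exists_zero := ⟨(HomotopyCategory.quotient _ _).obj 0,
    Functor.map_isZero _ (isZero_zero _), 0, 0,
    inferInstanceAs ((0 : CochainComplex A ℤ).IsStrictlyGE 0),
    inferInstanceAs ((0 : CochainComplex A ℤ).IsStrictlyLE 0)⟩

instance : (bounded A).IsStableUnderShift ℤ where
  isStableUnderShiftBy n :=
    { le_shift K hK := by
        obtain ⟨K, rfl⟩ := K.quotient_obj_surjective
        obtain ⟨a, b, ha, hb⟩ := hK
        change CochainComplex.IsStrictlyGE K a at ha
        change CochainComplex.IsStrictlyLE K b at hb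
        rw [ObjectProperty.prop_shift_iff, HomotopyCategory.shift_quotient_obj]
        exact ⟨a - n, b - n, CochainComplex.isStrictlyGE_shift K a n (a - n) (by lia),
          CochainComplex.isStrictlyLE_shift K b n (b - n) (by lia)⟩ }

instance : (bounded A).IsTriangulatedClosed₃ where
  ext₃' T hT h₁ h₂ := by
    obtain ⟨a₁, b₁, _, _⟩ := h₁
    obtain ⟨a₂, b₂, _, _⟩ := h₂
    obtain ⟨f : T.obj₁.as ⟶ T.obj₂.as, hf⟩ :=
      (HomotopyCategory.quotient _ _).map_surjective T.mor₁
    refine ⟨_, ?_, ⟨Triangle.π₃.mapIso (isoTriangleOfIso₁₂ T _ hT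
      (HomotopyCategory.mappingCone_triangleh_distinguished f) (Iso.refl _) (Iso.refl _) ?_)⟩⟩
    · refine ⟨min (a₁ - 1) a₂, max b₁ b₂,
        CochainComplex.isStrictlyGE_mappingCone f a₁ a₂ _ (by simp) (by simp), ?_⟩
      change (CochainComplex.mappingCone f).IsStrictlyLE _
      rw [CochainComplex.isStrictlyLE_iff]
      intro i hi
      simp only [CochainComplex.mappingCone.isZero_X_iff]
      exact ⟨CochainComplex.isZero_of_isStrictlyLE _ b₁ _ (by lia),
        CochainComplex.isZero_of_isStrictlyLE _ b₂ _ (by lia)⟩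
    · exact (Category.comp_id _).trans (hf.symm.trans (Category.id_comp _).symm)

instance : (bounded A).IsTriangulated where
  toIsTriangulatedClosed₂ := .of_isTriangulatedClosed₃

/-- The bounded homotopy category `K^b(A)`. -/
abbrev Kb := (bounded A).FullSubcategory

/-- The acyclic complexes, as a triangulated subcategory of `K^b(A)`. -/
abbrev acyclicKb : ObjectProperty (Kb A) :=
  (HomotopyCategory.subcategoryAcyclic A).inverseImage (bounded A).ι

/-- The bounded derived category `D^b(A)`: the Verdier quotient of `K^b(A)` by the acyclic
complexes. -/
abbrev Db := (acyclicKb A).trW.Localization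

end Bounded

/-! ### Subbifunctors of `Ext¹` -/

/-- An additive subbifunctor `F` of `Ext¹(-,-) : Aᵒᵖ × A ⥤ Ab`: a subgroup `F(Z, X)` of
`Ext¹(Z, X)` for all `Z` and `X`, stable under the maps induced by morphisms (i.e. pullback and
pushout of extensions). -/
structure ExtSubbifunctor (A : Type u) [Category.{v} A] [Abelian A] [HasExt.{w} A] where
  /-- the subgroup `F(Z, X)` of `Ext¹(Z, X)` -/
  obj (Z X : A) : AddSubgroup (Ext.{w} Z X 1)
  pullback_mem {Z' Z X : A} (f : Z' ⟶ Z) {x : Ext.{w} Z X 1} (hx : x ∈ obj Z X) :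
    (Ext.mk₀ f).comp x (zero_add 1) ∈ obj Z' X
  pushout_mem {Z X X' : A} (g : X ⟶ X') {x : Ext.{w} Z X 1} (hx : x ∈ obj Z X) :
    x.comp (Ext.mk₀ g) (add_zero 1) ∈ obj Z X'

/-- For a complex `X`, the sequence `im d^{i,j} ⟶ X^j ⟶ im d^{j,k}`. -/
def imageSequence {A : Type u} [Category.{v} A] [Abelian A] (X : CochainComplex A ℤ)
    (i j k : ℤ) : ShortComplex A :=
  ShortComplex.mk (image.ι (X.d i j)) (factorThruImage (X.d j k)) (by
    rw [← cancel_epi (factorThruImage (X.d i j)), ← cancel_mono (image.ι (X.d j k))]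
    simp)

namespace ExtSubbifunctor

variable {A : Type u} [Category.{v} A] [Abelian A] [HasExt.{w} A] (F : ExtSubbifunctor.{w} A)

/-- `F`-exact sequences: the short exact sequences `0 ⟶ X ⟶ Y ⟶ Z ⟶ 0` whose class in
`Ext¹(Z, X)` belongs to `F(Z, X)`. -/
def Exact (S : ShortComplex A) : Prop :=
  ∃ h : S.ShortExact, h.extClass ∈ F.obj S.X₃ S.X₁

/-- `F`-projective objects: `Hom(P, -)` sends `F`-exact sequences to exact sequences
(only surjectivity at the right end is not automatic). -/
def IsProjective : ObjectProperty A :=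
  fun P ↦ ∀ S : ShortComplex A, F.Exact S → ∀ f : P ⟶ S.X₃, ∃ g : P ⟶ S.X₂, g ≫ S.g = f

/-- `F`-injective objects: `Hom(-, I)` sends `F`-exact sequences to exact sequences. -/
def IsInjective : ObjectProperty A :=
  fun I ↦ ∀ S : ShortComplex A, F.Exact S → ∀ f : S.X₁ ⟶ I, ∃ g : S.X₂ ⟶ I, S.f ≫ g = f

/-- `F` has enough projectives: every object `Z` is the end of an `F`-exact sequence
`0 ⟶ X ⟶ P ⟶ Z ⟶ 0` with `P` an `F`-projective object. -/
class EnoughProjectives : Prop where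
  exists_exact (Z : A) : ∃ (X P : A) (f : X ⟶ P) (g : P ⟶ Z) (zero : f ≫ g = 0),
    F.IsProjective P ∧ F.Exact (ShortComplex.mk f g zero)

/-- `F` has enough injectives: every object `X` is the beginning of an `F`-exact sequence
`0 ⟶ X ⟶ I ⟶ Z ⟶ 0` with `I` an `F`-injective object. -/
class EnoughInjectives : Prop where
  exists_exact (X : A) : ∃ (I Z : A) (f : X ⟶ I) (g : I ⟶ Z) (zero : f ≫ g = 0),
    F.IsInjective I ∧ F.Exact (ShortComplex.mk f g zero)

/-- A complex `X` is `F`-acyclic if the sequences `0 ⟶ im d^{j-1} ⟶ X^j ⟶ im d^j ⟶ 0` are all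
`F`-exact. -/
def IsAcyclic (X : CochainComplex A ℤ) : Prop :=
  ∀ i j k : ℤ, i + 1 = j → j + 1 = k → F.Exact (imageSequence X i j k)

/-- The `F`-acyclic complexes, as objects of the homotopy category. -/
def acyclic : ObjectProperty (HomotopyCategory A (.up ℤ)) :=
  fun X ↦ F.IsAcyclic X.as

/-! If `F` has enough projectives, the `F`-acyclic complexes form a triangulated subcategory, so
that one may form the Verdier quotient. -/

section

variable {F}

lemma exact_of_lift [F.EnoughProjectives] {S : ShortComplex A} (hS : S.ShortExact)
    (h : ∀ P, F.IsProjective P → ∀ f : P ⟶ S.X₃, ∃ g : P ⟶ S.X₂, g ≫ S.g = f) : F.Exact S := by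
  refine ⟨hS, ?_⟩
  obtain ⟨K, P, i, p, zero, hP, hT, hmem⟩ := EnoughProjectives.exists_exact (F := F) S.X₃
  obtain ⟨g, hg⟩ := h P hP p
  have : Mono S.f := hS.mono_f
  let φ : ShortComplex.mk i p zero ⟶ S :=
    { τ₁ := hS.exact.lift (i ≫ g) (by rw [Category.assoc, hg, zero])
      τ₂ := g
      τ₃ := 𝟙 _
      comm₁₂ := hS.exact.lift_f _ _
      comm₂₃ := by simpa using hg }
  have key := ShortComplex.ShortExact.extClass_naturality hT hS φ
  have : hS.extClass = hT.extClass.comp (Ext.mk₀ φ.τ₁) (add_zero 1) := by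
    rw [key]
    exact (Ext.mk₀_id_comp _).symm
  rw [this]
  exact F.pushout_mem _ hmem

lemma isAcyclic_iff [F.EnoughProjectives] (X : CochainComplex A ℤ) :
    F.IsAcyclic X ↔ ∀ P, F.IsProjective P → ∀ i j k : ℤ, i + 1 = j → j + 1 = k →
      ∀ x : P ⟶ X.X j, x ≫ X.d j k = 0 → ∃ y : P ⟶ X.X i, y ≫ X.d i j = x := by
  constructor
  · intro h P hP i j k hij hjk x hx
    obtain ⟨hS, _⟩ := h i j k hij hjk
    have : Mono (imageSequence X i j k).f := hS.mono_f
    have hx' : x ≫ (imageSequence X i j k).g = 0 := by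
      change x ≫ factorThruImage (X.d j k) = 0
      rw [← cancel_mono (image.ι (X.d j k))]
      simpa using hx
    obtain ⟨y : P ⟶ X.X i, hy⟩ := hP _ (h (i - 1) i j (by lia) hij) (hS.exact.lift x hx')
    refine ⟨y, ?_⟩
    have h1 := hS.exact.lift_f x hx'
    rw [← hy] at h1
    change (y ≫ factorThruImage (X.d i j)) ≫ image.ι (X.d i j) = x at h1
    rw [Category.assoc, image.fac] at h1
    exact h1
  · intro h i j k hij hjk
    apply exact_of_lift
    · refine ShortComplex.ShortExact.mk' ?_ ?_ ?_
      · rw [ShortComplex.exact_iff_exact_up_to_refinements]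
        intro Z (x : Z ⟶ X.X j) hx
        obtain ⟨K, P, a, p, zero, hP, hT, -⟩ := EnoughProjectives.exists_exact (F := F) Z
        have hp : Epi p := hT.epi_g
        change x ≫ factorThruImage (X.d j k) = 0 at hx
        obtain ⟨y, hy⟩ := h P hP i j k hij hjk (p ≫ x) (by
          rw [← image.fac (X.d j k), Category.assoc, reassoc_of% hx, zero_comp, comp_zero])
        refine ⟨P, p, hp, y ≫ factorThruImage (X.d i j), ?_⟩
        change p ≫ x = (y ≫ factorThruImage (X.d i j)) ≫ image.ι (X.d i j)
        rw [Category.assoc, image.fac, hy]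
      · exact inferInstanceAs (Mono (image.ι (X.d i j)))
      · exact inferInstanceAs (Epi (factorThruImage (X.d j k)))
    · intro P hP (f : P ⟶ image (X.d j k))
      obtain ⟨y, hy⟩ := h P hP j k (k + 1) hjk rfl (f ≫ image.ι (X.d j k)) (by
        have : image.ι (X.d j k) ≫ X.d k (k + 1) = 0 := by
          rw [← cancel_epi (factorThruImage (X.d j k))]
          simp
        rw [Category.assoc, this, comp_zero])
      refine ⟨y, ?_⟩
      change y ≫ factorThruImage (X.d j k) = f
      rw [← cancel_mono (image.ι (X.d j k)), Category.assoc, image.fac, hy]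

end

/-- The complexes `X` such that `Hom(P, X)` is acyclic, as a full subcategory of the homotopy
category. -/
abbrev homAcyclic (P : A) : ObjectProperty (HomotopyCategory A (.up ℤ)) :=
  (HomotopyCategory.subcategoryAcyclic AddCommGrpCat.{v}).inverseImage
    ((preadditiveCoyoneda.obj (Opposite.op P)).mapHomotopyCategory (.up ℤ))

lemma acyclic_iff [F.EnoughProjectives] (X : HomotopyCategory A (.up ℤ)) :
    F.acyclic X ↔ ∀ P, F.IsProjective P → homAcyclic P X := by
  obtain ⟨X, rfl⟩ := X.quotient_obj_surjective
  refine (isAcyclic_iff X).trans ?_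
  refine forall_congr' fun P ↦ forall_congr' fun _ ↦ ?_
  let Y := ((preadditiveCoyoneda.obj (Opposite.op P)).mapHomologicalComplex (.up ℤ)).obj X
  change _ ↔ HomotopyCategory.subcategoryAcyclic AddCommGrpCat.{v}
    ((HomotopyCategory.quotient _ _).obj Y)
  rw [HomotopyCategory.quotient_obj_mem_subcategoryAcyclic_iff_exactAt]
  constructor
  · intro h n
    rw [HomologicalComplex.exactAt_iff' Y (n - 1) n (n + 1) (by simp) (by simp),
      ShortComplex.ab_exact_iff]
    exact fun x hx ↦ h (n - 1) n (n + 1) (by lia) rfl x hx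
  · intro h i j k hij hjk x hx
    have := h j
    rw [HomologicalComplex.exactAt_iff' Y i j k (by simp; lia) (by simp; lia),
      ShortComplex.ab_exact_iff] at this
    exact this x hx

instance [F.EnoughProjectives] : F.acyclic.IsClosedUnderIsomorphisms where
  of_iso e h := by
    rw [acyclic_iff] at h ⊢
    exact fun P hP ↦ (homAcyclic P).prop_of_iso e (h P hP)

instance [F.EnoughProjectives] : F.acyclic.IsTriangulated where
  exists_zero := ⟨0, isZero_zero _, (F.acyclic_iff _).2 fun P _ ↦ (homAcyclic P).prop_zero⟩
  isStableUnderShiftBy n := ⟨fun X hX ↦ (F.acyclic_iff _).2 fun P hP ↦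
    (homAcyclic P).le_shift n X ((F.acyclic_iff X).1 hX P hP)⟩
  toIsTriangulatedClosed₂ := .mk' fun T hT h₁ h₃ ↦ (F.acyclic_iff _).2 fun P hP ↦
    (homAcyclic P).ext_of_isTriangulatedClosed₂ T hT
      ((F.acyclic_iff _).1 h₁ P hP) ((F.acyclic_iff _).1 h₃ P hP)

/-- The bounded `F`-acyclic complexes, as a subcategory of `K^b(A)`. -/
abbrev acyclicKb : ObjectProperty (Kb A) := F.acyclic.inverseImage (bounded A).ι

/-- The bounded relative derived category `D_F^b(A)`: the Verdier quotient of `K^b(A)` by the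
`F`-acyclic complexes. -/
abbrev Db [F.EnoughProjectives] := F.acyclicKb.trW.Localization

end ExtSubbifunctor

/-! ### Grothendieck groups -/

section GrothendieckGroup

variable {A : Type u} [Category.{v} A] [Abelian A]

/-- The class of `X` in the free abelian group on the isomorphism classes of objects. -/
def freeClass (X : A) : FreeAbelianGroup (Quotient (isIsomorphicSetoid A)) :=
  FreeAbelianGroup.of (Quotient.mk _ X)

/-- The Grothendieck group of `A` with respect to a class `E` of sequences `X ⟶ Y ⟶ Z`: the free
abelian group on the isomorphism classes of objects, modulo the subgroup generated by the elements
`[X] + [Z] - [Y]`. -/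
def GrothendieckGroup (E : ShortComplex A → Prop) : Type _ :=
  FreeAbelianGroup (Quotient (isIsomorphicSetoid A)) ⧸
    AddSubgroup.closure {x | ∃ S : ShortComplex A, E S ∧
      x = freeClass S.X₁ + freeClass S.X₃ - freeClass S.X₂}

instance (E : ShortComplex A → Prop) : AddCommGroup (GrothendieckGroup E) :=
  inferInstanceAs (AddCommGroup (_ ⧸ _))

variable (A) in
/-- The Grothendieck group `K₀(A)`. -/
abbrev K₀ : Type _ := GrothendieckGroup (fun S : ShortComplex A ↦ S.ShortExact)

/-- The `F`-stable Grothendieck group `F-K₀(A)`. -/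
abbrev ExtSubbifunctor.K₀ [HasExt.{w} A] (F : ExtSubbifunctor.{w} A) : Type _ :=
  GrothendieckGroup F.Exact

end GrothendieckGroup

/-- Two triangulated categories are equivalent if there is an equivalence of categories that
commutes with the shifts and preserves distinguished triangles. -/
def TriangleEquivalent (C : Type u₁) [Category.{v₁} C] [HasZeroObject C] [HasShift C ℤ]
    [Preadditive C] [∀ n : ℤ, (shiftFunctor C n).Additive] [Pretriangulated C]
    (D : Type u₂) [Category.{v₂} D] [HasZeroObject D] [HasShift D ℤ]
    [Preadditive D] [∀ n : ℤ, (shiftFunctor D n).Additive] [Pretriangulated D] : Prop :=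
  ∃ (e : C ≌ D) (_ : e.functor.CommShift ℤ), e.functor.IsTriangulated

attribute [local instance] Abelian.hasFiniteBiproducts

/-- `add G`: the direct summands of finite direct sums of copies of `G`. -/
def add {A : Type u} [Category.{v} A] [Abelian A] (G : A) : ObjectProperty A :=
  fun X ↦ ∃ n : ℕ, Nonempty (Retract X (⨁ fun _ : Fin n ↦ G))

/-! ### Artin algebras -/

/-- A ring `Λ` is an Artin algebra if it is a finitely generated algebra (as a module) over some
commutative artinian ring `R`. (Replacing `R` by its image in `Λ`, one may take `R` in the same
universe as `Λ`.) -/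
class IsArtinAlgebra (Λ : Type u) [Ring Λ] : Prop where
  exists_base : ∃ (R : Type u) (_ : CommRing R) (_ : IsArtinianRing R) (_ : Algebra R Λ),
    Module.Finite R Λ

instance (Λ : Type u) [Ring Λ] [h : IsArtinAlgebra Λ] : IsNoetherianRing Λ := by
  obtain ⟨R, _, _, _, _⟩ := h.exists_base
  exact isNoetherian_of_tower R (isNoetherian_of_isNoetherianRing_of_finite R Λ)

/-- `Λ-mod`: the category of finitely generated left `Λ`-modules. -/
abbrev Mod (Λ : Type u) [Ring Λ] := FGModuleCat.{u} Λ

instance (Λ : Type u) [Ring Λ] [IsNoetherianRing Λ] : HasExt.{u + 1} (Mod Λ) :=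
  HasExt.standard _

/-- `Λ` (equipped with `F`) and `Γ` are relatively derived equivalent if `D_F^b(Λ-mod)` and
`D^b(Γ-mod)` are equivalent as triangulated categories. -/
def RelativelyDerivedEquivalent (Λ : Type u₁) [Ring Λ] [IsArtinAlgebra Λ]
    (F : ExtSubbifunctor (Mod Λ)) [F.EnoughProjectives]
    (Γ : Type u₂) [Ring Γ] [IsArtinAlgebra Γ] : Prop :=
  TriangleEquivalent F.Db (Db (Mod Γ))

end RelHom

end

/-! The Grothendieck group of a triangulated category is invariant under triangle equivalence, so it
suffices to identify both `F.K₀` and `K₀ (Mod Γ)` with the triangulated Grothendieck groups of the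
respective derived categories. Both are instances of
`GrothendieckGroup.nonempty_addEquiv_triangulatedK₀`: for a class `E` of short exact sequences and
the thick subcategory `N` of `E`-acyclic complexes, the group of `E` is that of `K^b(A)/N`.

One map sends `X` to the complex `X` in degree `0`. It respects the relations because an `E`-exact
sequence, read as a three-term complex, vanishes in the quotient, while the class of any bounded
complex is the alternating sum of the classes of its terms (`TriangleAdditive.toKb_eq_euler`).

The inverse is the Euler characteristic. It is additive on mapping cones, and it vanishes on `N` by
telescoping over the images of the differentials (`SplitAdditive.euler_eq_zero_of_imageSequence`).
It descends to the quotient because `N` is stable under retracts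
(`triangleAdditive_descendVerdier`). -/

noncomputable section

open CategoryTheory Limits Pretriangulated ZeroObject
open CategoryTheory.Abelian (Ext)

namespace RelHom

/-! ### Grothendieck groups of triangulated categories -/

section TriangulatedK₀

variable (C : Type u₁) [Category.{v₁} C] [HasZeroObject C] [HasShift C ℤ]
  [Preadditive C] [∀ n : ℤ, (shiftFunctor C n).Additive] [Pretriangulated C]

/-- A function on the objects of a triangulated category is additive if
`t Y = t X + t Z` for all distinguished triangles `X ⟶ Y ⟶ Z ⟶ X⟦1⟧`. -/
def TriangleAdditive {C : Type u₁} [Category.{v₁} C] [HasZeroObject C] [HasShift C ℤ]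
    [Preadditive C] [∀ n : ℤ, (shiftFunctor C n).Additive] [Pretriangulated C]
    {G : Type*} [AddCommGroup G] (t : C → G) : Prop :=
  ∀ T ∈ distTriang C, t T.obj₂ = t T.obj₁ + t T.obj₃

/-- The Grothendieck group of a triangulated category. -/
def TriangulatedK₀ : Type _ :=
  FreeAbelianGroup C ⧸ AddSubgroup.closure {x | ∃ T ∈ distTriang C,
    x = FreeAbelianGroup.of T.obj₁ + FreeAbelianGroup.of T.obj₃ - FreeAbelianGroup.of T.obj₂}

instance : AddCommGroup (TriangulatedK₀ C) := inferInstanceAs (AddCommGroup (_ ⧸ _))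

namespace TriangulatedK₀

variable {C}

/-- The class of an object in the Grothendieck group. -/
def mk (X : C) : TriangulatedK₀ C := QuotientAddGroup.mk (FreeAbelianGroup.of X)

lemma triangleAdditive_mk : TriangleAdditive (mk : C → TriangulatedK₀ C) := by
  intro T hT
  have h : mk T.obj₁ + mk T.obj₃ - mk T.obj₂ = 0 :=
    (QuotientAddGroup.eq_zero_iff _).2 (AddSubgroup.subset_closure ⟨T, hT, rfl⟩)
  exact (sub_eq_zero.1 h).symm

/-- The universal property of the Grothendieck group. -/
def lift {G : Type*} [AddCommGroup G] (t : C → G) (ht : TriangleAdditive t) :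
    TriangulatedK₀ C →+ G :=
  QuotientAddGroup.lift _ (FreeAbelianGroup.lift t) (by
    rw [AddSubgroup.closure_le]
    rintro _ ⟨T, hT, rfl⟩
    simp [ht T hT])

@[simp]
lemma lift_mk {G : Type*} [AddCommGroup G] (t : C → G) (ht : TriangleAdditive t) (X : C) :
    lift t ht (mk X) = t X :=
  FreeAbelianGroup.lift_apply_of t X

lemma hom_ext {G : Type*} [AddCommGroup G] {f g : TriangulatedK₀ C →+ G}
    (h : ∀ X, f (mk X) = g (mk X)) : f = g :=
  QuotientAddGroup.addMonoidHom_ext _ (FreeAbelianGroup.lift_ext _ _ h)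

end TriangulatedK₀

namespace TriangleAdditive

variable {C} {G : Type*} [AddCommGroup G] {t : C → G} (ht : TriangleAdditive t)

include ht

lemma eq_zero {X : C} (hX : IsZero X) : t X = 0 := by
  have h := ht (Triangle.mk (0 : X ⟶ X) (0 : X ⟶ X) 0)
    ((Triangle.distinguished_iff_of_isZero₃ _ hX).2
      ⟨0, hX.eq_of_src _ _, hX.eq_of_src _ _⟩)
  simpa using h

lemma eq_of_iso {X Y : C} (e : X ≅ Y) : t X = t Y := by
  have h := ht (Triangle.mk e.hom (0 : Y ⟶ 0) 0)
    ((Triangle.distinguished_iff_of_isZero₃ _ (isZero_zero C)).2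
      (inferInstanceAs (IsIso e.hom)))
  have h0 := ht.eq_zero (isZero_zero C)
  change t Y = t X + t 0 at h
  rw [h, h0, add_zero]

/-- Rotating the contractible triangle on `X` gives `X ⟶ 0 ⟶ X⟦1⟧`. -/
lemma shift_one (X : C) : t (X⟦(1 : ℤ)⟧) = -t X := by
  have h := ht _ (rot_of_distTriang _ (contractible_distinguished X))
  change t 0 = t X + t (X⟦(1 : ℤ)⟧) at h
  rw [ht.eq_zero (isZero_zero C)] at h
  exact (neg_eq_of_add_eq_zero_right h.symm).symm

end TriangleAdditive

end TriangulatedK₀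

section

variable {C : Type u₁} [Category.{v₁} C] [HasZeroObject C] [HasShift C ℤ]
  [Preadditive C] [∀ n : ℤ, (shiftFunctor C n).Additive] [Pretriangulated C]
  {D : Type u₂} [Category.{v₂} D] [HasZeroObject D] [HasShift D ℤ]
  [Preadditive D] [∀ n : ℤ, (shiftFunctor D n).Additive] [Pretriangulated D]

lemma TriangleAdditive.comp_functor {G : Type*} [AddCommGroup G] {t : D → G}
    (ht : TriangleAdditive t) (L : C ⥤ D) [L.CommShift ℤ] [L.IsTriangulated] :
    TriangleAdditive (fun X ↦ t (L.obj X)) :=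
  fun T hT ↦ ht _ (L.map_distinguished T hT)

lemma TriangleEquivalent.nonempty_triangulatedK₀_addEquiv (h : TriangleEquivalent C D) :
    Nonempty (TriangulatedK₀ C ≃+ TriangulatedK₀ D) := by
  obtain ⟨e, _, _⟩ := h
  let _ : e.inverse.CommShift ℤ := e.commShiftInverse ℤ
  have : e.CommShift ℤ := e.commShift_of_functor ℤ
  have : e.IsTriangulated := Equivalence.IsTriangulated.mk' e inferInstance
  have hC := TriangulatedK₀.triangleAdditive_mk (C := C)
  have hD := TriangulatedK₀.triangleAdditive_mk (C := D)
  refine ⟨AddMonoidHom.toAddEquiv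
    (TriangulatedK₀.lift _ (hD.comp_functor e.functor))
    (TriangulatedK₀.lift _ (hC.comp_functor e.inverse)) ?_ ?_⟩
  · exact TriangulatedK₀.hom_ext fun X ↦ by
      simpa using hC.eq_of_iso (e.unitIso.app X).symm
  · exact TriangulatedK₀.hom_ext fun X ↦ by
      simpa using hD.eq_of_iso (e.counitIso.app X)

/-! ### Verdier quotients -/

section Verdier

variable (N : ObjectProperty C)

/-- The descent to a Verdier quotient of an additive function vanishing on the kernel. -/
def descendVerdier {G : Type*} (t : C → G) (X : N.trW.Localization) : G :=
  t ((Localization.Construction.objEquiv N.trW).symm X)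

/-- True by `rfl` because the constructed localization has the same objects as `C`. Invariance under
isomorphisms of the quotient is the real issue, settled in `eq_of_trW_Q_obj_iso`. -/
lemma descendVerdier_Q_obj {G : Type*} (t : C → G) (X : C) :
    descendVerdier N t (N.trW.Q.obj X) = t X := rfl

variable [IsTriangulated C] [N.IsTriangulated]

lemma isZero_trW_Q_obj {X : C} (hX : N X) : IsZero (N.trW.Q.obj X) := by
  have h : N.trW (0 : X ⟶ 0) := by
    rw [ObjectProperty.trW_iff']
    exact ⟨X, 𝟙 X, 0, contractible_distinguished X, hX⟩
  have := Localization.inverts N.trW.Q N.trW _ h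
  exact (N.trW.Q.map_isZero (isZero_zero C)).of_iso (asIso (N.trW.Q.map (0 : X ⟶ 0)))

variable [N.IsClosedUnderIsomorphisms]

/-- If `X` dies in the quotient, some morphism `s` out of `X` with cone in `N` is zero. The cone of
a zero morphism has `X⟦1⟧` as a retract, so thickness gives the claim. -/
lemma of_isZero_trW_Q_obj [N.IsStableUnderRetracts] {X : C} (hX : IsZero (N.trW.Q.obj X)) :
    N X := by
  obtain ⟨Y, s, hs, fac⟩ := (MorphismProperty.map_eq_iff_postcomp N.trW.Q N.trW
    (𝟙 X) 0).1 (hX.eq_of_src _ _)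
  obtain ⟨Z, g, h, hT, hZ⟩ := hs
  obtain rfl : s = 0 := by simpa using fac
  obtain ⟨i, hi⟩ := Triangle.coyoneda_exact₁ _ hT (𝟙 _)
    ((Category.id_comp _).trans (Functor.map_zero _ _ _))
  have hX' : N (X⟦(1 : ℤ)⟧) := N.prop_of_retract
    { i := i, r := h, retract := hi.symm } hZ
  exact (N.prop_shift_iff_of_isStableUnderShift X 1).1 hX'

/-- Write the isomorphism as a left fraction of `f` by `s`. The cone of `s` is in `N`; `f` becomes
invertible, so its cone dies in the quotient and is in `N` by `of_isZero_trW_Q_obj`. Hence `t` is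
constant along both. -/
lemma eq_of_trW_Q_obj_iso [N.IsStableUnderRetracts] {G : Type*} [AddCommGroup G] {t : C → G}
    (ht : TriangleAdditive t) (h₀ : ∀ X, N X → t X = 0) {X Y : C}
    (e : N.trW.Q.obj X ≅ N.trW.Q.obj Y) : t X = t Y := by
  obtain ⟨φ, hφ⟩ := Localization.exists_leftFraction N.trW.Q N.trW e.hom
  have aux {X Y : C} (f : X ⟶ Y) (hf : N.trW f) : t X = t Y := by
    obtain ⟨Z, g, h, hT, hZ⟩ := hf
    have := ht _ hT
    change t Y = t X + t Z at this
    rw [this, h₀ _ hZ, add_zero]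
  rw [aux _ φ.hs]
  have h1 : e.hom ≫ N.trW.Q.map φ.s = N.trW.Q.map φ.f := by
    rw [hφ, MorphismProperty.LeftFraction.map_comp_map_s]
  have := Localization.inverts N.trW.Q N.trW _ φ.hs
  have h2 : IsIso (N.trW.Q.map φ.f) := by rw [← h1]; infer_instance
  obtain ⟨Z, g, h, hT⟩ := distinguished_cocone_triangle φ.f
  exact aux _ ⟨Z, g, h, hT, of_isZero_trW_Q_obj N
    (Triangle.isZero₃_of_isIso₁ _ (N.trW.Q.map_distinguished _ hT) h2)⟩

lemma triangleAdditive_descendVerdier [N.IsStableUnderRetracts] {G : Type*} [AddCommGroup G]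
    {t : C → G} (ht : TriangleAdditive t) (h₀ : ∀ X, N X → t X = 0) :
    TriangleAdditive (descendVerdier N t) := by
  rintro T ⟨T', e, hT'⟩
  -- A distinguished triangle of the quotient is only isomorphic to the image of one of `C`, so each
  -- vertex has to be moved along an isomorphism of the quotient.
  have aux {X : N.trW.Localization} {Y : C} (e : X ≅ N.trW.Q.obj Y) :
      descendVerdier N t X = t Y := by
    obtain ⟨X, rfl⟩ := (Localization.Construction.objEquiv N.trW).surjective X
    exact eq_of_trW_Q_obj_iso N ht h₀ e
  have h₁ : descendVerdier N t T.obj₁ = t T'.obj₁ := aux (Triangle.π₁.mapIso e)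
  have h₂ : descendVerdier N t T.obj₂ = t T'.obj₂ := aux (Triangle.π₂.mapIso e)
  have h₃ : descendVerdier N t T.obj₃ = t T'.obj₃ := aux (Triangle.π₃.mapIso e)
  rw [h₁, h₂, h₃]
  exact ht _ hT'

end Verdier

end

/-! ### Euler characteristics of bounded complexes -/

section Euler

variable {A : Type u} [Category.{v} A] [Abelian A] {G : Type*} [AddCommGroup G]

/-- A function on the objects of an additive category is split additive if
`c Y = c X + c Z` for all split exact sequences `0 ⟶ X ⟶ Y ⟶ Z ⟶ 0`. -/
def SplitAdditive (c : A → G) : Prop :=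
  ∀ S : ShortComplex A, S.Splitting → c S.X₂ = c S.X₁ + c S.X₃

namespace SplitAdditive

variable {c : A → G} (hc : SplitAdditive c)

include hc

lemma eq_zero {X : A} (hX : IsZero X) : c X = 0 := by
  have h := hc (ShortComplex.mk (0 : X ⟶ X) (0 : X ⟶ X) (by simp))
    { r := 0
      s := 0
      f_r := hX.eq_of_src _ _
      s_g := hX.eq_of_src _ _
      id := hX.eq_of_src _ _ }
  simpa using h

lemma eq_of_iso {X Y : A} (e : X ≅ Y) : c X = c Y := by
  have h := hc (ShortComplex.mk e.hom (0 : Y ⟶ 0) (by simp))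
    { r := e.inv
      s := 0
      f_r := e.hom_inv_id
      s_g := (isZero_zero A).eq_of_src _ _
      id := by simp }
  change c Y = c X + c 0 at h
  rw [h, hc.eq_zero (isZero_zero A), add_zero]

end SplitAdditive

/-- A cochain complex which is bounded on both sides. -/
def IsBounded (K : CochainComplex A ℤ) : Prop :=
  ∃ a b : ℤ, CochainComplex.IsStrictlyGE K a ∧ CochainComplex.IsStrictlyLE K b

lemma IsBounded.hasFiniteSupport {K : CochainComplex A ℤ} (hK : IsBounded K) {f : ℤ → G}
    (hf : ∀ i, IsZero (K.X i) → f i = 0) : f.HasFiniteSupport := by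
  obtain ⟨a, b, _, _⟩ := hK
  refine (Set.finite_Icc a b).subset fun i hi ↦ ?_
  by_contra h
  rw [Set.mem_Icc, not_and_or, not_le, not_le] at h
  refine hi (hf i ?_)
  obtain h | h := h
  · exact K.isZero_of_isStrictlyGE a i h
  · exact K.isZero_of_isStrictlyLE b i h

lemma IsBounded.of_isZero {K L : CochainComplex A ℤ} (hK : IsBounded K)
    (h : ∀ i, IsZero (K.X i) → IsZero (L.X i)) : IsBounded L := by
  obtain ⟨a, b, _, _⟩ := hK
  refine ⟨a, b, ?_, ?_⟩
  · rw [CochainComplex.isStrictlyGE_iff]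
    exact fun i hi ↦ h i (K.isZero_of_isStrictlyGE a i hi)
  · rw [CochainComplex.isStrictlyLE_iff]
    exact fun i hi ↦ h i (K.isZero_of_isStrictlyLE b i hi)

/-- The Euler characteristic of a complex, with respect to a function on objects. -/
def euler (c : A → G) (K : CochainComplex A ℤ) : G := ∑ᶠ i : ℤ, i.negOnePow • c (K.X i)

variable {c : A → G}

/-- A `finsum` with infinite support is `0` by convention, so additivity of `euler` depends on this.
-/
lemma SplitAdditive.hasFiniteSupport (hc : SplitAdditive c) {K : CochainComplex A ℤ}
    (hK : IsBounded K) :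
    (fun i : ℤ ↦ i.negOnePow • c (K.X i)).HasFiniteSupport :=
  hK.hasFiniteSupport fun i hi ↦ by simp [hc.eq_zero hi]

lemma SplitAdditive.euler_eq_add (hc : SplitAdditive c) (S : ShortComplex (CochainComplex A ℤ))
    (σ : ∀ n, (S.map (HomologicalComplex.eval A _ n)).Splitting)
    (h₁ : IsBounded S.X₁) (h₃ : IsBounded S.X₃) :
    euler c S.X₂ = euler c S.X₁ + euler c S.X₃ := by
  unfold euler
  rw [← finsum_add_distrib (hc.hasFiniteSupport h₁) (hc.hasFiniteSupport h₃)]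
  refine finsum_congr fun i ↦ ?_
  rw [← smul_add]
  congr 1
  exact hc _ (σ i)

lemma SplitAdditive.euler_eq_zero_of_isZero (hc : SplitAdditive c) {K : CochainComplex A ℤ}
    (hK : ∀ i, IsZero (K.X i)) : euler c K = 0 := by
  unfold euler
  simp [fun i ↦ hc.eq_zero (hK i)]

lemma euler_shift_one (c : A → G) (K : CochainComplex A ℤ) :
    euler c (K⟦(1 : ℤ)⟧) = - euler c K := by
  unfold euler
  rw [← finsum_neg_distrib]
  rw [← finsum_comp_equiv (Equiv.addRight (1 : ℤ))
    (f := fun i ↦ -(i.negOnePow • c (K.X i)))]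
  refine finsum_congr fun i ↦ ?_
  simp [Int.negOnePow_succ]

lemma SplitAdditive.euler_single (hc : SplitAdditive c) (X : A) (n : ℤ) :
    euler c ((CochainComplex.singleFunctor A n).obj X) = n.negOnePow • c X := by
  unfold euler
  rw [finsum_eq_single _ n]
  · congr 1
    exact hc.eq_of_iso (HomologicalComplex.singleObjXSelf (.up ℤ) n X)
  · intro i hi
    exact (congrArg _ (hc.eq_zero
      (HomologicalComplex.isZero_single_obj_X (.up ℤ) n X i hi))).trans (smul_zero _)

lemma IsBounded.shift_one {K : CochainComplex A ℤ} (hK : IsBounded K) :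
    IsBounded (K⟦(1 : ℤ)⟧) := by
  obtain ⟨a, b, _, _⟩ := hK
  exact ⟨a - 1, b - 1, K.isStrictlyGE_shift a 1 (a - 1) (by lia),
    K.isStrictlyLE_shift b 1 (b - 1) (by lia)⟩

lemma IsBounded.single (X : A) (n : ℤ) :
    IsBounded ((CochainComplex.singleFunctor A n).obj X) :=
  ⟨n, n, inferInstance, inferInstance⟩

/-- The cone is a degreewise split extension of `K⟦1⟧` by `L`. -/
lemma SplitAdditive.euler_mappingCone (hc : SplitAdditive c) {K L : CochainComplex A ℤ}
    (φ : K ⟶ L) (hK : IsBounded K) (hL : IsBounded L) :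
    euler c (CochainComplex.mappingCone φ) = euler c L - euler c K := by
  have h := hc.euler_eq_add (CochainComplex.mappingCone.triangleRotateShortComplex φ)
    (CochainComplex.mappingCone.triangleRotateShortComplexSplitting φ) hL hK.shift_one
  change euler c (CochainComplex.mappingCone φ) = euler c L + euler c (K⟦(1 : ℤ)⟧) at h
  rw [h, euler_shift_one, sub_eq_add_neg]

/-- Each term splits into the classes of two consecutive images; each image occurs in two adjacent
degrees, with opposite signs. -/
lemma SplitAdditive.euler_eq_zero_of_imageSequence (hc : SplitAdditive c)
    {K : CochainComplex A ℤ} (hK : IsBounded K)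
    (h : ∀ i j k : ℤ, i + 1 = j → j + 1 = k →
      c (K.X j) = c (image (K.d i j)) + c (image (K.d j k))) :
    euler c K = 0 := by
  let I (j : ℤ) : G := j.negOnePow • c (image (K.d j (j + 1)))
  have hI : I.HasFiniteSupport := hK.hasFiniteSupport fun i hi ↦ by
    have : IsZero (image (K.d i (i + 1))) := IsZero.of_epi (factorThruImage _) hi
    simp [I, hc.eq_zero this]
  have hI' : (fun j ↦ I (j + 1)).HasFiniteSupport :=
    hI.comp_of_injective (Equiv.addRight (1 : ℤ)).injective
  have hI'' : (fun j ↦ - I j).HasFiniteSupport := by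
    simpa [Function.HasFiniteSupport] using hI
  unfold euler
  -- After this reindexing the term at `j` is `- I j + I (j + 1)`.
  rw [← finsum_comp_equiv (Equiv.addRight (1 : ℤ))]
  calc _ = ∑ᶠ j, (- I j + I (j + 1)) := finsum_congr fun j ↦ by
        simp [I, h j (j + 1) (j + 1 + 1) rfl rfl, Int.negOnePow_succ]
    _ = 0 := by
      have := finsum_comp_equiv (Equiv.addRight (1 : ℤ)) (f := I)
      simp only [Equiv.coe_addRight] at this
      rw [finsum_add_distrib hI'' hI', finsum_neg_distrib, this, neg_add_cancel]

end Euler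

/-! ### Dévissage of bounded complexes into their terms -/

section Devissage

variable {A : Type u} [Category.{v} A] [Abelian A]

/-- A bounded cochain complex, as an object of `K^b(A)`. -/
def toKb (K : CochainComplex A ℤ) (hK : IsBounded K) : Kb A :=
  ⟨(HomotopyCategory.quotient A (.up ℤ)).obj K, hK⟩

variable {G : Type*} [AddCommGroup G] {t : Kb A → G} (ht : TriangleAdditive t)

include ht

/-- A degreewise split sequence of complexes is distinguished in the homotopy category, so its third
term is isomorphic to the cone of `S.f` formed in `K^b(A)`. -/
lemma TriangleAdditive.toKb_eq_add (S : ShortComplex (CochainComplex A ℤ))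
    (σ : ∀ n, (S.map (HomologicalComplex.eval A _ n)).Splitting)
    (h₁ : IsBounded S.X₁) (h₂ : IsBounded S.X₂) (h₃ : IsBounded S.X₃) :
    t (toKb S.X₂ h₂) = t (toKb S.X₁ h₁) + t (toKb S.X₃ h₃) := by
  let f : toKb S.X₁ h₁ ⟶ toKb S.X₂ h₂ :=
    (bounded A).homMk ((HomotopyCategory.quotient A (.up ℤ)).map S.f)
  obtain ⟨Z, g, h, hT⟩ := distinguished_cocone_triangle f
  have hS : CochainComplex.trianglehOfDegreewiseSplit S σ ∈ distTriang _ :=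
    (HomotopyCategory.distinguished_iff_iso_trianglehOfDegreewiseSplit _).2
      ⟨S, σ, ⟨Iso.refl _⟩⟩
  have e := isoTriangleOfIso₁₂ _ _ ((bounded A).ι.map_distinguished _ hT) hS
    (Iso.refl _) (Iso.refl _) ((Category.comp_id _).trans (Category.id_comp _).symm)
  let e₃ : Z ≅ toKb S.X₃ h₃ := (bounded A).isoMk (Triangle.π₃.mapIso e)
  rw [← ht.eq_of_iso e₃]
  exact ht _ hT

lemma TriangleAdditive.toKb_eq_zero {K : CochainComplex A ℤ} (hK : IsBounded K)
    (h : ∀ i, IsZero (K.X i)) : t (toKb K hK) = 0 := by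
  refine ht.eq_zero ?_
  have : IsZero K := by
    rw [IsZero.iff_id_eq_zero]
    ext i
    exact (h i).eq_of_src _ _
  have h' := (HomotopyCategory.quotient A (.up ℤ)).map_isZero this
  rw [IsZero.iff_id_eq_zero] at h' ⊢
  ext
  exact h'

/-- The object of `K^b(A)` attached to an object of `A`, in degree `n`. -/
def singleKb (n : ℤ) (X : A) : Kb A :=
  toKb ((CochainComplex.singleFunctor A n).obj X) (.single X n)

lemma TriangleAdditive.splitAdditive_singleKb (n : ℤ) :
    SplitAdditive (fun X : A ↦ t (singleKb n X)) := by
  intro S s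
  exact ht.toKb_eq_add (S.map (CochainComplex.singleFunctor A n))
    (fun i ↦ s.map (CochainComplex.singleFunctor A n ⋙ HomologicalComplex.eval A _ i)) _ _ _

/-- `X` in degree `n` is the shift by `1` of `X` in degree `n + 1`. -/
lemma TriangleAdditive.singleKb_eq_neg (n : ℤ) (X : A) :
    t (singleKb n X) = - t (singleKb (n + 1) X) := by
  rw [← ht.shift_one]
  refine ht.eq_of_iso ((bounded A).isoMk ?_)
  exact (HomotopyCategory.quotient A (.up ℤ)).mapIso
    (((CochainComplex.singleFunctors A).shiftIso 1 n (n + 1) (by lia)).app X).symm ≪≫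
    ((HomotopyCategory.quotient A (.up ℤ)).commShiftIso (1 : ℤ)).app
      ((CochainComplex.singleFunctor A (n + 1)).obj X) ≪≫
    ((bounded A).ι.commShiftIso (1 : ℤ)).symm.app (singleKb (n + 1) X)

lemma TriangleAdditive.singleKb_eq_smul (n : ℤ) (X : A) :
    t (singleKb n X) = n.negOnePow • t (singleKb 0 X) := by
  induction n using Int.induction_on with
  | zero => simp
  | succ n hn =>
    rw [Int.negOnePow_succ, Units.neg_smul, ← hn, ht.singleKb_eq_neg n, neg_neg]
  | pred n hn =>
    rw [ht.singleKb_eq_neg, sub_add_cancel, hn, Int.negOnePow_sub]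
    simp

lemma TriangleAdditive.toKb_eq_euler (K : CochainComplex A ℤ) (hK : IsBounded K) :
    t (toKb K hK) = euler (fun X ↦ t (singleKb 0 X)) K := by
  have hc := ht.splitAdditive_singleKb 0
  -- Induction on the number `n` of degrees in the interval `[a, a + n - 1]` supporting `K`; for `n
  -- = 0` it is empty and `K` vanishes.
  suffices ∀ (n : ℕ) (a : ℤ) (K : CochainComplex A ℤ) (_ : K.IsStrictlyGE a)
      (_ : K.IsStrictlyLE (a + n - 1)) (hK : IsBounded K),
      t (toKb K hK) = euler (fun X ↦ t (singleKb 0 X)) K by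
    obtain ⟨a, b, _, _⟩ := id hK
    refine this (b + 1 - a).toNat a K inferInstance ?_ hK
    exact CochainComplex.isStrictlyLE_of_le K b _ (by lia)
  intro n
  induction n with
  | zero =>
    intro a K _ _ hK
    have hK₀ (i : ℤ) : IsZero (K.X i) := by
      by_cases hi : i < a
      · exact K.isZero_of_isStrictlyGE a i hi
      · exact K.isZero_of_isStrictlyLE (a + (0 : ℕ) - 1) i (by grind)
    rw [ht.toKb_eq_zero hK hK₀, hc.euler_eq_zero_of_isZero hK₀]
  | succ n hn =>
    intro a K _ _ hK
    -- The lowest term is a quotient complex, as nothing nonzero maps into degree `a`. The kernel of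
    -- `π` is the brutal truncation above `a`, supported in one degree fewer.
    let π : K ⟶ (HomologicalComplex.single A (.up ℤ) a).obj (K.X a) :=
      HomologicalComplex.mkHomToSingle (𝟙 _) (fun i hi ↦
        (K.isZero_of_isStrictlyGE a i (by simp at hi; lia)).eq_of_src _ _)
    -- A section in each degree only; it need not commute with the differentials.
    let s (i : ℤ) : ((HomologicalComplex.single A (.up ℤ) a).obj (K.X a)).X i ⟶ K.X i :=
      if h : i = a then
        (HomologicalComplex.singleObjXIsoOfEq (.up ℤ) a (K.X a) i h).hom ≫
          (K.XIsoOfEq h).inv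
      else 0
    have hs (i : ℤ) : s i ≫ π.f i = 𝟙 _ := by
      by_cases h : i = a
      · subst h
        simp only [s, π, dif_pos, HomologicalComplex.XIsoOfEq_rfl, Iso.refl_inv,
          HomologicalComplex.mkHomToSingle_f, Category.comp_id, Category.id_comp]
        exact (HomologicalComplex.singleObjXSelf (.up ℤ) i (K.X i)).hom_inv_id
      · exact (HomologicalComplex.isZero_single_obj_X (.up ℤ) a _ i h).eq_of_src _ _
    let S : ShortComplex (CochainComplex A ℤ) :=
      ShortComplex.mk (kernel.ι π) π (kernel.condition π)
    have hS : S.Exact := ShortComplex.exact_of_f_is_kernel _ (kernelIsKernel π)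
    have : Mono S.f := inferInstanceAs (Mono (kernel.ι π))
    have hS' (i : ℤ) : (S.map (HomologicalComplex.eval A _ i)).Exact :=
      hS.map_of_mono_of_preservesKernel _ inferInstance inferInstance
    have hmono (i : ℤ) : Mono (S.f.f i) := inferInstance
    let σ (i : ℤ) : (S.map (HomologicalComplex.eval A _ i)).Splitting :=
      ShortComplex.Splitting.ofExactOfSection _ (hS' i) (s i) (hs i) (hmono i)
    have hL (i : ℤ) (hi : IsZero (K.X i)) : IsZero (S.X₁.X i) := IsZero.of_mono (S.f.f i) hi
    have hL' : IsZero (S.X₁.X a) := by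
      have h₁ : S.f.f a ≫ π.f a = 0 := by
        rw [← HomologicalComplex.comp_f, S.zero, HomologicalComplex.zero_f]
      have h₂ : Mono (π.f a) := by
        dsimp only [π]
        rw [HomologicalComplex.mkHomToSingle_f]
        infer_instance
      have h₃ : S.f.f a = 0 := by rw [← cancel_mono (π.f a), h₁, zero_comp]
      rw [IsZero.iff_id_eq_zero, ← cancel_mono (S.f.f a), h₃, comp_zero, comp_zero]
    have hLb : IsBounded S.X₁ := hK.of_isZero hL
    rw [ht.toKb_eq_add S σ hLb hK (.single _ _), hc.euler_eq_add S σ hLb (.single _ _),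
      hn (a + 1) S.X₁ ?_ ?_ hLb]
    · congr 1
      exact (ht.singleKb_eq_smul a (K.X a)).trans (hc.euler_single (K.X a) a).symm
    · rw [CochainComplex.isStrictlyGE_iff]
      intro i hi
      obtain rfl | hi := eq_or_ne i a
      · exact hL'
      · exact hL i (K.isZero_of_isStrictlyGE a i (by lia))
    · rw [CochainComplex.isStrictlyLE_iff]
      intro i hi
      exact hL i (K.isZero_of_isStrictlyLE (a + (n + 1 : ℕ) - 1) i (by grind))

end Devissage

/-! ### The Euler characteristic as an additive function on `K^b(A)` -/

section EulerKb

variable {A : Type u} [Category.{v} A] [Abelian A] {G : Type*} [AddCommGroup G] {c : A → G}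

lemma IsBounded.mappingCone {K L : CochainComplex A ℤ} (f : K ⟶ L)
    (hK : IsBounded K) (hL : IsBounded L) : IsBounded (CochainComplex.mappingCone f) := by
  obtain ⟨a₁, b₁, _, _⟩ := hK
  obtain ⟨a₂, b₂, _, _⟩ := hL
  refine ⟨min (a₁ - 1) a₂, max b₁ b₂,
    CochainComplex.isStrictlyGE_mappingCone f a₁ a₂ _ (by simp) (by simp), ?_⟩
  rw [CochainComplex.isStrictlyLE_iff]
  intro i hi
  simp only [CochainComplex.mappingCone.isZero_X_iff]
  exact ⟨K.isZero_of_isStrictlyLE b₁ _ (by lia), L.isZero_of_isStrictlyLE b₂ _ (by lia)⟩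

variable (hc : SplitAdditive c) (N : ObjectProperty (Kb A)) [N.IsTriangulated]
  [N.IsClosedUnderIsomorphisms] (hN : ∀ X, N X → euler c X.obj.as = 0)

include hc hN

/-- A homotopy equivalence has contractible cone, which is zero in `K^b(A)` and hence lies in `N`.
This spares a direct proof that contractible complexes have Euler characteristic zero. -/
lemma SplitAdditive.euler_eq_of_iso {X Y : Kb A} (e : X ≅ Y) :
    euler c X.obj.as = euler c Y.obj.as := by
  obtain ⟨f : X.obj.as ⟶ Y.obj.as, hf⟩ :=
    (HomotopyCategory.quotient _ _).map_surjective e.hom.hom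
  have hcone := IsBounded.mappingCone f X.property Y.property
  have hZ : IsZero (CochainComplex.mappingCone.triangleh f).obj₃ :=
    Triangle.isZero₃_of_isIso₁ _
      (HomotopyCategory.mappingCone_triangleh_distinguished f) (by
        change IsIso ((HomotopyCategory.quotient _ _).map f)
        rw [hf]
        exact inferInstanceAs (IsIso ((bounded A).ι.map e.hom)))
  have hZ' : IsZero (toKb _ hcone) := by
    rw [IsZero.iff_id_eq_zero] at hZ ⊢
    ext
    exact hZ
  have h := hN _ (N.prop_of_isZero hZ')
  change euler c (CochainComplex.mappingCone f) = 0 at h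
  rw [hc.euler_mappingCone f X.property Y.property] at h
  exact (sub_eq_zero.1 h).symm

/-- The first morphism lifts to a chain map, and the third vertex is isomorphic to its mapping cone.
-/
lemma SplitAdditive.triangleAdditive_euler :
    TriangleAdditive (fun X : Kb A ↦ euler c X.obj.as) := by
  intro T hT
  obtain ⟨f : T.obj₁.obj.as ⟶ T.obj₂.obj.as, hf⟩ :=
    (HomotopyCategory.quotient _ _).map_surjective T.mor₁.hom
  have hcone := IsBounded.mappingCone f T.obj₁.property T.obj₂.property
  let e := isoTriangleOfIso₁₂ _ _ ((bounded A).ι.map_distinguished _ hT)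
    (HomotopyCategory.mappingCone_triangleh_distinguished f) (Iso.refl _) (Iso.refl _)
    ((Category.comp_id _).trans (hf.symm.trans (Category.id_comp _).symm))
  let e₃ : T.obj₃ ≅ toKb _ hcone := (bounded A).isoMk (Triangle.π₃.mapIso e)
  have h₃ := hc.euler_eq_of_iso N hN e₃
  change euler c T.obj₃.obj.as = euler c (CochainComplex.mappingCone f) at h₃
  rw [hc.euler_mappingCone f T.obj₁.property T.obj₂.property] at h₃
  dsimp only
  rw [h₃, add_sub_cancel]

end EulerKb

/-! ### Short complexes as complexes -/

section ThreeTerm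

variable {A : Type u} [Category.{v} A] [Abelian A] (S : ShortComplex A)

/-- The objects of the complex attached to a short complex. -/
def threeTermX : ℤ → A
  | 0 => S.X₁
  | 1 => S.X₂
  | 2 => S.X₃
  | _ => 0

/-- The differentials of the complex attached to a short complex. -/
def threeTermD : ∀ i : ℤ, threeTermX S i ⟶ threeTermX S (i + 1)
  | 0 => S.f
  | 1 => S.g
  | _ => 0

lemma isZero_threeTermX (i : ℤ) (h₀ : i ≠ 0) (h₁ : i ≠ 1) (h₂ : i ≠ 2) :
    IsZero (threeTermX S i) := by
  unfold threeTermX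
  split <;> first | contradiction | exact isZero_zero A

/-- The complex `X₁ ⟶ X₂ ⟶ X₃` attached to a short complex, in degrees `0`, `1`, `2`. -/
def threeTerm : CochainComplex A ℤ :=
  CochainComplex.of (threeTermX S) (threeTermD S) (by
    intro i
    by_cases h₀ : i = 0
    · subst h₀; exact S.zero
    · by_cases h₁ : i < 0
      · exact (isZero_threeTermX S i (by lia) (by lia) (by lia)).eq_of_src _ _
      · exact (isZero_threeTermX S (i + 1 + 1) (by lia) (by lia) (by lia)).eq_of_tgt _ _)

lemma threeTerm_d_zero : (threeTerm S).d 0 1 = S.f :=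
  CochainComplex.of_d (threeTermX S) (threeTermD S) 0

lemma threeTerm_d_one : (threeTerm S).d 1 2 = S.g :=
  CochainComplex.of_d (threeTermX S) (threeTermD S) 1

lemma isBounded_threeTerm : IsBounded (threeTerm S) := by
  refine ⟨0, 2, ?_, ?_⟩
  · rw [CochainComplex.isStrictlyGE_iff]
    exact fun i hi ↦ isZero_threeTermX S i (by lia) (by lia) (by lia)
  · rw [CochainComplex.isStrictlyLE_iff]
    exact fun i hi ↦ isZero_threeTermX S i (by lia) (by lia) (by lia)

lemma SplitAdditive.euler_threeTerm {G : Type*} [AddCommGroup G] {c : A → G}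
    (hc : SplitAdditive c) :
    euler c (threeTerm S) = c S.X₁ - c S.X₂ + c S.X₃ := by
  unfold euler
  rw [finsum_eq_sum_of_support_subset (s := {0, 1, 2})]
  · have h₂ : Int.negOnePow 2 = 1 := rfl
    rw [Finset.sum_insert (by simp), Finset.sum_insert (by simp), Finset.sum_singleton,
      Int.negOnePow_zero, Int.negOnePow_one, h₂, one_smul, one_smul, Units.neg_smul, one_smul]
    change c S.X₁ + (- c S.X₂ + c S.X₃) = _
    abel
  · intro i hi
    by_contra h
    simp only [Finset.coe_insert, Finset.coe_singleton, Set.mem_insert_iff,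
      Set.mem_singleton_iff, not_or] at h
    refine hi ?_
    have : c ((threeTerm S).X i) = 0 :=
      hc.eq_zero (isZero_threeTermX S i h.1 h.2.1 h.2.2)
    simp [this]

lemma threeTerm_exactAt (hS : S.ShortExact) (i : ℤ) : (threeTerm S).ExactAt i := by
  by_cases h₀ : i = 0
  · subst h₀
    rw [HomologicalComplex.exactAt_iff' _ (-1) 0 1 (by simp) (by simp),
      ShortComplex.exact_iff_mono _
        ((isZero_threeTermX S (-1) (by simp) (by simp) (by simp)).eq_of_src _ _)]
    change Mono ((threeTerm S).d 0 1)
    rw [threeTerm_d_zero]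
    exact hS.mono_f
  by_cases h₁ : i = 1
  · subst h₁
    rw [HomologicalComplex.exactAt_iff' _ 0 1 2 (by simp) (by simp)]
    refine (ShortComplex.exact_iff_of_iso (S₁ := S) (S₂ := (threeTerm S).sc' 0 1 2) (ShortComplex.isoMk (Iso.refl _)
      (Iso.refl _) (Iso.refl _) ?_ ?_)).1 hS.exact
    · exact (Category.id_comp _).trans
        ((threeTerm_d_zero S).trans (Category.comp_id S.f).symm)
    · exact (Category.id_comp _).trans
        ((threeTerm_d_one S).trans (Category.comp_id S.g).symm)
  by_cases h₂ : i = 2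
  · subst h₂
    rw [HomologicalComplex.exactAt_iff' _ 1 2 3 (by simp) (by simp),
      ShortComplex.exact_iff_epi _
        ((isZero_threeTermX S 3 (by simp) (by simp) (by simp)).eq_of_tgt _ _)]
    change Epi ((threeTerm S).d 1 2)
    rw [threeTerm_d_one]
    exact hS.epi_g
  · exact ShortComplex.exact_of_isZero_X₂ _ (isZero_threeTermX S i h₀ h₁ h₂)

/-- By `isAcyclic_iff` this is exactness of `Hom(P, -)` of the complex. Degrees `0` and `1` (`i =
-1` and `i = 0`) follow from left exactness; degree `2` is the lifting property of `P`. -/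
lemma threeTerm_isAcyclic [HasExt.{w} A] (F : ExtSubbifunctor.{w} A) [F.EnoughProjectives]
    (hS : F.Exact S) : F.IsAcyclic (threeTerm S) := by
  rw [ExtSubbifunctor.isAcyclic_iff]
  rintro P hP i j k rfl rfl x hx
  obtain ⟨hS', _⟩ := id hS
  have hmono := hS'.mono_f
  by_cases h₀ : i = -1
  · subst h₀
    refine ⟨0, ?_⟩
    change P ⟶ S.X₁ at x
    change x ≫ (threeTerm S).d 0 1 = 0 at hx
    rw [threeTerm_d_zero] at hx
    have hx' : x = 0 := (cancel_mono S.f).1 (hx.trans zero_comp.symm)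
    rw [zero_comp]
    exact hx'.symm
  by_cases h₁ : i = 0
  · subst h₁
    change P ⟶ S.X₂ at x
    change x ≫ (threeTerm S).d 1 2 = 0 at hx
    rw [threeTerm_d_one] at hx
    refine ⟨hS'.exact.lift x hx, ?_⟩
    change _ ≫ (threeTerm S).d 0 1 = _
    rw [threeTerm_d_zero]
    exact hS'.exact.lift_f x hx
  by_cases h₂ : i = 1
  · subst h₂
    obtain ⟨y, hy⟩ := hP S hS x
    refine ⟨y, ?_⟩
    change _ ≫ (threeTerm S).d 1 2 = _
    rw [threeTerm_d_one]
    exact hy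
  · exact ⟨0, (isZero_threeTermX S (i + 1) (by lia) (by lia) (by lia)).eq_of_tgt _ _⟩

end ThreeTerm

/-! ### Comparison of Grothendieck groups -/

namespace GrothendieckGroup

variable {A : Type u} [Category.{v} A] [Abelian A] {E : ShortComplex A → Prop}

/-- The class of an object in the Grothendieck group. -/
def mk (E : ShortComplex A → Prop) (X : A) : GrothendieckGroup E :=
  QuotientAddGroup.mk (freeClass X)

lemma mk_eq_add {S : ShortComplex A} (hS : E S) : mk E S.X₂ = mk E S.X₁ + mk E S.X₃ := by
  have h : mk E S.X₁ + mk E S.X₃ - mk E S.X₂ = 0 :=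
    (QuotientAddGroup.eq_zero_iff _).2 (AddSubgroup.subset_closure ⟨S, hS, rfl⟩)
  exact (sub_eq_zero.1 h).symm

/-- The universal property of the Grothendieck group. -/
def lift {G : Type*} [AddCommGroup G] (c : A → G) (hc : ∀ X Y : A, (X ≅ Y) → c X = c Y)
    (hE : ∀ S, E S → c S.X₂ = c S.X₁ + c S.X₃) : GrothendieckGroup E →+ G :=
  QuotientAddGroup.lift _
    (FreeAbelianGroup.lift (Quotient.lift c fun X Y ⟨e⟩ ↦ hc X Y e)) (by
      rw [AddSubgroup.closure_le]
      rintro _ ⟨S, hS, rfl⟩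
      simp [freeClass, hE S hS])

@[simp]
lemma lift_mk {G : Type*} [AddCommGroup G] (c : A → G) (hc : ∀ X Y : A, (X ≅ Y) → c X = c Y)
    (hE : ∀ S, E S → c S.X₂ = c S.X₁ + c S.X₃) (X : A) :
    lift c hc hE (mk E X) = c X :=
  FreeAbelianGroup.lift_apply_of _ _

lemma hom_ext {G : Type*} [AddCommGroup G] {f g : GrothendieckGroup E →+ G}
    (h : ∀ X, f (mk E X) = g (mk E X)) : f = g :=
  QuotientAddGroup.addMonoidHom_ext _ (FreeAbelianGroup.lift_ext _ _ (by
    rintro ⟨X⟩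
    exact h X))

/-- The Grothendieck group of a class `E` of short exact sequences is isomorphic to that of the
Verdier quotient of `K^b(A)` by the `E`-acyclic complexes. -/
theorem nonempty_addEquiv_triangulatedK₀ (N : ObjectProperty (Kb A)) [N.IsTriangulated]
    [N.IsClosedUnderIsomorphisms] [N.IsStableUnderRetracts]
    (hE : ∀ S : ShortComplex A, S.Splitting → E S)
    (hN : ∀ X, N X → ∀ i j k : ℤ, i + 1 = j → j + 1 = k → E (imageSequence X.obj.as i j k))
    (hN' : ∀ S, E S → N (toKb (threeTerm S) (isBounded_threeTerm S))) :
    Nonempty (GrothendieckGroup E ≃+ TriangulatedK₀ N.trW.Localization) := by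
  have hmk : SplitAdditive (mk E) := fun S s ↦ mk_eq_add (hE S s)
  have hχ₀ (X : Kb A) (hX : N X) : euler (mk E) X.obj.as = 0 :=
    hmk.euler_eq_zero_of_imageSequence X.property fun i j k hij hjk ↦
      mk_eq_add (hN X hX i j k hij hjk)
  have hχ := hmk.triangleAdditive_euler N hχ₀
  let t (X : Kb A) : TriangulatedK₀ N.trW.Localization := TriangulatedK₀.mk (N.trW.Q.obj X)
  have ht : TriangleAdditive t := TriangulatedK₀.triangleAdditive_mk.comp_functor N.trW.Q
  have ht₀ (X : Kb A) (hX : N X) : t X = 0 :=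
    TriangulatedK₀.triangleAdditive_mk.eq_zero (isZero_trW_Q_obj N hX)
  have hc := ht.splitAdditive_singleKb 0
  let φ : GrothendieckGroup E →+ TriangulatedK₀ N.trW.Localization :=
    -- The three-term complex of `S` is zero in the quotient, and its class is the alternating sum
    -- of the classes of its terms.
    lift (fun X ↦ t (singleKb 0 X)) (fun X Y e ↦ hc.eq_of_iso e) (fun S hS ↦ by
      have h := ht₀ _ (hN' S hS)
      rw [ht.toKb_eq_euler, hc.euler_threeTerm] at h
      rw [← sub_eq_zero, ← neg_eq_zero, ← h]
      abel)
  let ψ : TriangulatedK₀ N.trW.Localization →+ GrothendieckGroup E :=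
    TriangulatedK₀.lift _ (triangleAdditive_descendVerdier N hχ hχ₀)
  refine ⟨AddMonoidHom.toAddEquiv φ ψ (hom_ext fun X ↦ ?_) (TriangulatedK₀.hom_ext fun X ↦ ?_)⟩
  · simp only [AddMonoidHom.comp_apply, φ, ψ, lift_mk, t, TriangulatedK₀.lift_mk,
      descendVerdier_Q_obj, AddMonoidHom.id_apply]
    exact (hmk.euler_single X 0).trans (by simp)
  · obtain ⟨X, rfl⟩ := (Localization.Construction.objEquiv N.trW).surjective X
    have h : ψ (TriangulatedK₀.mk (N.trW.Q.obj X)) = euler (mk E) X.obj.as :=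
      TriangulatedK₀.lift_mk _ _ _
    change φ (ψ (TriangulatedK₀.mk (N.trW.Q.obj X))) = t X
    rw [h]
    -- By dévissage the class of a complex is the alternating sum of the classes of its terms, which
    -- is `φ` applied to its Euler characteristic.
    refine Eq.trans ?_ (ht.toKb_eq_euler X.obj.as X.property).symm
    unfold euler
    rw [AddMonoidHom.map_finsum _ (hmk.hasFiniteSupport X.property)]
    refine finsum_congr fun i ↦ ?_
    obtain h | h := Int.even_or_odd i
    · simp [Int.negOnePow_even i h, φ]
    · simp [Int.negOnePow_odd i h, φ]

end GrothendieckGroup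

/-! ### Stability under retracts of acyclic complexes -/

section Retracts

variable {A : Type u} [Category.{v} A] [Abelian A]

/-- Homology carries retracts to retracts, and a retract of zero is zero. -/
instance : (HomotopyCategory.subcategoryAcyclic A).IsStableUnderRetracts where
  of_retract r h := by
    rw [HomotopyCategory.mem_subcategoryAcyclic_iff] at h ⊢
    exact fun n ↦ IsZero.of_mono (r.map (HomotopyCategory.homologyFunctor A _ n)).i (h n)

instance {C : Type u₁} [Category.{v₁} C] {D : Type u₂} [Category.{v₂} D] (P : ObjectProperty D)
    [P.IsStableUnderRetracts] (L : C ⥤ D) : (P.inverseImage L).IsStableUnderRetracts where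
  of_retract r h := P.prop_of_retract (r.map L) h

/-- `F`-acyclicity is acyclicity of `Hom(P, -)` for all `F`-projective `P`, which reduces this to
complexes of abelian groups. -/
instance [HasExt.{w} A] (F : ExtSubbifunctor.{w} A) [F.EnoughProjectives] :
    F.acyclic.IsStableUnderRetracts where
  of_retract r h := by
    rw [ExtSubbifunctor.acyclic_iff] at h ⊢
    exact fun P hP ↦ (ExtSubbifunctor.homAcyclic P).prop_of_retract r (h P hP)

/-- The relative Grothendieck group is that of the bounded relative derived category. -/
theorem ExtSubbifunctor.nonempty_K₀_addEquiv [HasExt.{w} A] (F : ExtSubbifunctor.{w} A)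
    [F.EnoughProjectives] : Nonempty (F.K₀ ≃+ TriangulatedK₀ F.Db) := by
  refine GrothendieckGroup.nonempty_addEquiv_triangulatedK₀ F.acyclicKb ?_ ?_ ?_
  -- Split sequences are `F`-exact, since every morphism lifts through the section.
  · exact fun S s ↦ ExtSubbifunctor.exact_of_lift s.shortExact fun P _ f ↦
      ⟨f ≫ s.s, by rw [Category.assoc, s.s_g, Category.comp_id]⟩
  · exact fun X hX ↦ hX
  · exact fun S hS ↦ threeTerm_isAcyclic S F hS

lemma imageSequence_shortExact {K : CochainComplex A ℤ} (hK : ∀ n, K.ExactAt n) (i j k : ℤ)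
    (hij : i + 1 = j) (hjk : j + 1 = k) : (imageSequence K i j k).ShortExact := by
  have h := hK j
  rw [HomologicalComplex.exactAt_iff' _ i j k (by simp; lia) (by simp; lia)] at h
  refine ShortComplex.ShortExact.mk' ?_ (inferInstanceAs (Mono (image.ι (K.d i j))))
    (inferInstanceAs (Epi (factorThruImage (K.d j k))))
  rw [ShortComplex.exact_iff_exact_up_to_refinements] at h ⊢
  intro Z (x : Z ⟶ K.X j) hx
  change x ≫ factorThruImage (K.d j k) = 0 at hx
  obtain ⟨Z', p, hp, y : Z' ⟶ K.X i, hy⟩ := h x (by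
    change x ≫ K.d j k = 0
    rw [← image.fac (K.d j k), reassoc_of% hx, zero_comp])
  refine ⟨Z', p, hp, y ≫ factorThruImage (K.d i j), ?_⟩
  change p ≫ x = (y ≫ factorThruImage (K.d i j)) ≫ image.ι (K.d i j)
  rw [Category.assoc, image.fac]
  exact hy

variable (A) in
/-- The Grothendieck group of an abelian category is that of its bounded derived category. -/
theorem nonempty_K₀_addEquiv : Nonempty (K₀ A ≃+ TriangulatedK₀ (Db A)) := by
  refine GrothendieckGroup.nonempty_addEquiv_triangulatedK₀ (acyclicKb A) ?_ ?_ ?_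
  · exact fun S s ↦ s.shortExact
  · intro X hX i j k hij hjk
    have hX' : ∀ n, X.obj.as.ExactAt n :=
      (HomotopyCategory.quotient_obj_mem_subcategoryAcyclic_iff_exactAt _).1 hX
    exact imageSequence_shortExact hX' i j k hij hjk
  · exact fun S hS ↦ (HomotopyCategory.quotient_obj_mem_subcategoryAcyclic_iff_exactAt _).2
      (threeTerm_exactAt S hS)

end Retracts

end RelHom

end

theorem proposition6p3 {Λ : Type u₁} [Ring Λ] [RelHom.IsArtinAlgebra Λ]
    {Γ : Type u₂} [Ring Γ] [RelHom.IsArtinAlgebra Γ]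
    (F : RelHom.ExtSubbifunctor (RelHom.Mod Λ)) [F.EnoughProjectives] [F.EnoughInjectives]
    (G : RelHom.Mod Λ) (hG : F.IsProjective = RelHom.add G)
    (h : RelHom.RelativelyDerivedEquivalent Λ F Γ) :
    Nonempty (F.K₀ ≃+ RelHom.K₀ (RelHom.Mod Γ)) := by
  obtain ⟨e₁⟩ := F.nonempty_K₀_addEquiv
  obtain ⟨e₂⟩ := h.nonempty_triangulatedK₀_addEquiv
  obtain ⟨e₃⟩ := RelHom.nonempty_K₀_addEquiv (RelHom.Mod Γ)
  exact ⟨e₁.trans (e₂.trans e₃.symm)⟩
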